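/- Let $n\ge 0$, let $S^{2n+1}\subset\mathbb{C}^{n+1}$ be the unit sphere with coordinate functions $z_1,\dots,z_{n+1}$, and let $\zeta_0=z_0,\ \zeta_j=z_0z_j$ $(1\le j\le n+1)$ be homogeneous coordinates on $\mathbb{C}^{n+2}$, with null cone $\mathcal N=\{\zeta\neq0:\ |\zeta_0|^2=\sum_{j=1}^{n+1}|\zeta_j|^2\}$ and Laplacian $$\boldsymbol\Delta=-2\Big(-\frac{\partial^2}{\partial\zeta_0\partial\bar\zeta_0}+\sum_{j=1}^{n+1}\frac{\partial^2}{\partial\zeta_j\partial\bar\zeta_j}\Big)$$ of the flat Lorentz–Kähler ambient metric. For $w,w'\in\mathbb{C}$ such that $k=w+w'+n+1$ is a nonnegative integer and $f\in C^\infty(S^{2n+1};\mathbb{C})$, define $$P_{w,w'}f=z_0^{\,k-w}\,\bar z_0^{\,k-w'}\;2^{-k}\,(\boldsymbol\Delta^k\boldsymbol F)\big|_{\mathcal N},$$ where $\boldsymbol F$ is any smooth function, defined locally near points of $\mathcal N$, that is homogeneous of bidegree $(w,w')$, i.e. $\sum_{i=0}^{n+1}\zeta_i\,\partial\boldsymbol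 F/\partial\zeta_i=w\boldsymbol F$ and $\sum_{i=0}^{n+1}\bar\zeta_i\,\partial\boldsymbol F/\partial\bar\zeta_i=w'\boldsymbol F$, and satisfies $\boldsymbol F|_{\mathcal N}=z_0^{w}\bar z_0^{w'}f$. (The result is independent of the choice of $\boldsymbol F$ and of bidegree $(0,0)$, hence a function on $S^{2n+1}$; if $w-w'\notin\mathbb{Z}$, the powers of $z_0$ are taken with the branch equal to $1$ at $z_0=1$, and the result is evaluated at $z_0=1$. For $k=0$, $P_{w,w'}$ is the identity.) Suppose that $k=w+w'+n+1$ is a positive integer. Then, as operators on $C^\infty(S^{2n+1};\mathbb{C})$, $$\sum_{j=1}^{n+1}\bar z_j\,[P_{w,w'},z_j]=-k\,(w'-k+1)\,P_{w-1,w'},$$ where $[P,z_j]u=P(z_ju)-z_jP(u)$. -/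

import Mathlib

open scoped Manifold ContDiff ComplexConjugate Topology

noncomputable section

namespace CRSphere

/-- The unit sphere `S^{2n+1}` in `ℂ^{n+1}`, with the standard smooth structure of Mathlib. -/
abbrev Sph (n : ℕ) : Type :=
  Metric.sphere (0 : EuclideanSpace ℂ (Fin (n + 1))) 1

instance factFinrank (n : ℕ) :
    Fact (Module.finrank ℝ (EuclideanSpace ℂ (Fin (n + 1))) = 2 * n + 1 + 1) :=
  ⟨by
    rw [← Module.finrank_mul_finrank ℝ ℂ (EuclideanSpace ℂ (Fin (n + 1))),
      Complex.finrank_real_complex, finrank_euclideanSpace_fin]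
    ring⟩

/-- `u ∈ C^∞(S^{2n+1}; ℂ)`. -/
def SmoothOnSphere (n : ℕ) (u : Sph n → ℂ) : Prop :=
  ContMDiff (𝓡 (2 * n + 1)) 𝓘(ℝ, ℂ) ∞ u

/-- The coordinate function `z_j` on the sphere (indices start from `0`). -/
def coord {n : ℕ} (j : Fin (n + 1)) (z : Sph n) : ℂ :=
  (z : EuclideanSpace ℂ (Fin (n + 1))) j

/-- The ambient space `ℂ^{n+2}` with coordinates `ζ_0, …, ζ_{n+1}`. -/
abbrev Amb (n : ℕ) : Type := Fin (n + 2) → ℂ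

/-- Wirtinger derivative `∂F/∂ζ_i`. -/
def dζ {n : ℕ} (i : Fin (n + 2)) (F : Amb n → ℂ) (ζ : Amb n) : ℂ :=
  (1 / 2) * (fderiv ℝ F ζ (Pi.single i 1) - Complex.I * fderiv ℝ F ζ (Pi.single i Complex.I))

/-- Wirtinger derivative `∂F/∂ζ̄_i`. -/
def dζbar {n : ℕ} (i : Fin (n + 2)) (F : Amb n → ℂ) (ζ : Amb n) : ℂ :=
  (1 / 2) * (fderiv ℝ F ζ (Pi.single i 1) + Complex.I * fderiv ℝ F ζ (Pi.single i Complex.I))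

/-- The holomorphic Euler field `Z = ∑ ζ_i ∂/∂ζ_i`. -/
def eulerZ {n : ℕ} (F : Amb n → ℂ) (ζ : Amb n) : ℂ :=
  ∑ i, ζ i * dζ i F ζ

/-- The antiholomorphic Euler field `Z̄ = ∑ ζ̄_i ∂/∂ζ̄_i`. -/
def eulerZbar {n : ℕ} (F : Amb n → ℂ) (ζ : Amb n) : ℂ :=
  ∑ i, conj (ζ i) * dζbar i F ζ

/-- The Laplacian (with the sign convention `-∇^a ∇_a`) `Δ = -2 (-∂_0 ∂_{0̄} + ∑_{j ≥ 1} ∂_j ∂_{j̄})` of the flat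
Lorentz-Kähler metric `i (-dζ_0 ∧ dζ̄_0 + ∑_{j ≥ 1} dζ_j ∧ dζ̄_j)`. -/
def ambLaplacian {n : ℕ} (F : Amb n → ℂ) (ζ : Amb n) : ℂ :=
  -2 * (-(dζ 0 (dζbar 0 F) ζ) + ∑ j : Fin (n + 1), dζ j.succ (dζbar j.succ F) ζ)

/-- The homogeneous coordinates `ζ_0 = z_0`, `ζ_j = z_0 z_j`. For `z_0 ≠ 0` and `z` in the sphere
these are exactly the points of the null cone `|ζ_0|² = ∑_{j ≥ 1} |ζ_j|²`, `ζ ≠ 0`. -/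
def homCoord {n : ℕ} (z₀ : ℂ) (z : Sph n) : Amb n :=
  Fin.cons z₀ fun j => z₀ * coord j z

/-- `z_0^v z̄_0^{v'}` for `z_0 ≠ 0`. It does not depend on the branch of the logarithm when
`v - v' ∈ ℤ`; otherwise it is the branch which is smooth near `z_0 = 1`, with value `1` there. -/
def bipow (v v' : ℂ) (z₀ : ℂ) : ℂ :=
  Complex.exp (v * Complex.log z₀ + v' * conj (Complex.log z₀))

/-- `F` is a smooth function near `ζ`, homogeneous of bidegree `(w, w')`, i.e. a germ at `ζ` of the
sheaf of homogeneous functions on the ambient space. -/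
def IsHomogeneousNear {n : ℕ} (w w' : ℂ) (F : Amb n → ℂ) (ζ : Amb n) : Prop :=
  ∀ᶠ η in 𝓝 ζ, ContDiffAt ℝ ∞ F η ∧ eulerZ F η = w * F η ∧ eulerZbar F η = w' * F η

/-- Near the point of the null cone over `z` with `z_0 = 1`, `F` is a smooth homogeneous function of
bidegree `(w, w')` whose restriction to the null cone is `z_0^w z̄_0^{w'} f`. -/
def IsAmbientExtension {n : ℕ} (w w' : ℂ) (f : Sph n → ℂ) (z : Sph n) (F : Amb n → ℂ) : Prop :=
  IsHomogeneousNear w w' F (homCoord 1 z) ∧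
    ∀ᶠ p : ℂ × Sph n in 𝓝 (1, z), F (homCoord p.1 p.2) = bipow w w' p.1 * f p.2

open Classical in
/-- The operator `P_{w,w'}` of order `2k`, `k = w + w' + n + 1`: extend `z_0^w z̄_0^{w'} f` from the
null cone to an (arbitrarily chosen) homogeneous function `F`, restrict `2^{-k} Δ^k F` to the null
cone and multiply by `z_0^{k-w} z̄_0^{k-w'}`. The result has bidegree `(0, 0)`, so as a function on the
sphere it is its value at `z_0 = 1`. The choice of `F` is immaterial for `k = w + w' + n + 1`. -/
def gjms (n k : ℕ) (w w' : ℂ) (f : Sph n → ℂ) (z : Sph n) : ℂ :=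
  if h : ∃ F : Amb n → ℂ, IsAmbientExtension w w' f z F then
    bipow (k - w) (k - w') 1 *
      ((1 / 2 : ℂ) ^ k * (ambLaplacian^[k] h.choose) (homCoord 1 z))
  else 0

/-- The commutator `[P, φ] u = P (φ u) - φ P u` with the multiplication operator by `φ`. -/
def commMul {n : ℕ} (P : (Sph n → ℂ) → Sph n → ℂ) (φ : Sph n → ℂ) (u : Sph n → ℂ) (z : Sph n) : ℂ :=
  P (fun y => φ y * u y) z - φ z * P u z

end CRSphere

end

/-!
Near a point of the null cone, write `r = -|ζ_0|² + ∑ |ζ_j|²`. Two homogeneous extensions of the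
same function differ by `r G`, and since `r`, `Δ` and the Euler operators generate an `sl₂`,
`Δ^k (r G) = r Δ^k G + c (w + w' + n + 1 - k) Δ^{k-1} G` for a constant `c`, which vanishes on the
cone when `k = w + w' + n + 1`. Hence `P_{w,w'}` may be computed from any extension.

If `G` extends `u` with bidegree `(w - 1, w')`, then `ζ_0 G` and `ζ_j G` extend `u` and `z_j u`
with bidegree `(w, w')`. The commutator `[Δ^k, ζ_i]` is a multiple of `k ∂/∂ζ̄_i Δ^{k-1}`, so at
`z_0 = 1` the sum `∑ z̄_j [P_{w,w'}, z_j] u` is `-k 2^{1-k}` times the conjugate Euler operator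
applied to `Δ^{k-1} G`, which is homogeneous of degree `w' - k + 1` in `ζ̄`.
-/

noncomputable section

namespace CRSphere

section SmoothDivision

universe u

variable {E F : Type u} [NormedAddCommGroup E] [NormedSpace ℝ E] [FiniteDimensional ℝ E]
  [NormedAddCommGroup F] [NormedSpace ℝ F]

theorem contDiff_nat_intervalIntegral [CompleteSpace F] (m : ℕ) {f : E × ℝ → F}
    (hf : ContDiff ℝ m f) (a b : ℝ) : ContDiff ℝ m fun x => ∫ s in a..b, f (x, s) := by
  induction m generalizing F with
  | zero =>
    rw [Nat.cast_zero, contDiff_zero] at hf ⊢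
    exact intervalIntegral.continuous_parametric_intervalIntegral_of_continuous'
      (f := fun x s => f (x, s)) hf a b
  | succ m ih =>
    have hpartial : ContDiff ℝ m fun q : E × ℝ =>
        (fderiv ℝ f q).comp (ContinuousLinearMap.inl ℝ E ℝ) :=
      (hf.fderiv_right (by norm_cast)).clm_comp contDiff_const
    have hcont := hf.continuous
    have hdiff : Differentiable ℝ f := hf.differentiable (by simp)
    push_cast
    refine contDiff_succ_iff_hasFDerivAt.2 ⟨_, ih hpartial, fun x => ?_⟩
    obtain ⟨C, hC⟩ := ((isCompact_closedBall x (1 : ℝ)).prod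
      (isCompact_uIcc (a := a) (b := b))).exists_bound_of_continuousOn
        hpartial.continuous.continuousOn
    exact intervalIntegral.hasFDerivAt_integral_of_dominated_of_fderiv_le
      (F := fun y s => f (y, s))
      (F' := fun y s => (fderiv ℝ f (y, s)).comp (ContinuousLinearMap.inl ℝ E ℝ))
      (bound := fun _ => C) (Metric.closedBall_mem_nhds x one_pos)
      (.of_forall fun y => (hcont.comp (.prodMk_right y)).aestronglyMeasurable)
      ((hcont.comp (.prodMk_right x)).intervalIntegrable _ _)
      (hpartial.continuous.comp (.prodMk_right x)).aestronglyMeasurable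
      (.of_forall fun s hs y hy => hC (y, s) ⟨hy, Set.uIoc_subset_uIcc hs⟩)
      intervalIntegrable_const
      (.of_forall fun s _ y _ => (hdiff (y, s)).hasFDerivAt.comp y (hasFDerivAt_prodMk_left y s))

theorem contDiff_infty_intervalIntegral [CompleteSpace F] {f : E × ℝ → F}
    (hf : ContDiff ℝ ∞ f) (a b : ℝ) : ContDiff ℝ ∞ fun x => ∫ s in a..b, f (x, s) :=
  contDiff_infty.2 fun m => contDiff_nat_intervalIntegral m (contDiff_infty.1 hf m) a b

theorem exists_contDiff_sub_eq_apply_sub [CompleteSpace F] {f : E → F} (hf : ContDiff ℝ ∞ f) :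
    ∃ Φ : E × E → E →L[ℝ] F, ContDiff ℝ ∞ Φ ∧ ∀ x y, f y - f x = Φ (x, y) (y - x) := by
  have hf' : ContDiff ℝ ∞ (fderiv ℝ f) := hf.fderiv_right (by simp)
  refine ⟨fun q => ∫ s in (0 : ℝ)..1, fderiv ℝ f (q.1 + s • (q.2 - q.1)), ?_, fun x y => ?_⟩
  · exact contDiff_infty_intervalIntegral
      (f := fun r : (E × E) × ℝ => fderiv ℝ f (r.1.1 + r.2 • (r.1.2 - r.1.1)))
      (hf'.comp (by fun_prop)) 0 1
  · have hderiv (s : ℝ) : HasDerivAt (fun s : ℝ => f (x + s • (y - x)))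
        (fderiv ℝ f (x + s • (y - x)) (y - x)) s := by
      have hline : HasDerivAt (fun s : ℝ => x + s • (y - x)) (y - x) s := by
        simpa using ((hasDerivAt_id s).smul_const (y - x)).const_add x
      exact (hf.differentiable (by simp) _).hasFDerivAt.comp_hasDerivAt s hline
    have hcont : Continuous fun s : ℝ => fderiv ℝ f (x + s • (y - x)) :=
      hf'.continuous.comp (by fun_prop)
    have hftc := intervalIntegral.integral_eq_sub_of_hasDerivAt (fun s _ => hderiv s)
      ((hcont.clm_apply continuous_const).intervalIntegrable 0 1)
    rw [ContinuousLinearMap.intervalIntegral_apply (hcont.intervalIntegrable 0 1), hftc]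
    simp

theorem exists_contDiff_eventuallyEq {f : E → F} {p : E}
    (hf : ∀ᶠ x in 𝓝 p, ContDiffAt ℝ ∞ f x) : ∃ g : E → F, ContDiff ℝ ∞ g ∧ g =ᶠ[𝓝 p] f := by
  obtain ⟨ε, hε, hball⟩ := Metric.eventually_nhds_iff_ball.1 hf
  let χ : ContDiffBump p := ⟨ε / 4, ε / 2, by positivity, by linarith⟩
  refine ⟨fun x => χ x • f x, contDiff_iff_contDiffAt.2 fun x => ?_, ?_⟩
  · by_cases hx : x ∈ tsupport χ
    · rw [χ.tsupport_eq] at hx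
      exact χ.contDiffAt.smul (hball x (Metric.closedBall_subset_ball (half_lt_self hε) hx))
    · refine (contDiffAt_const (c := (0 : F))).congr_of_eventuallyEq ?_
      filter_upwards [notMem_tsupport_iff_eventuallyEq.1 hx] with y hy
      simp [hy]
  · filter_upwards [χ.eventuallyEq_one] with x hx
    simp [hx]

theorem exists_contDiff_localInverse [FiniteDimensional ℝ F] {Ψ : E → F}
    {Ψ' : E ≃L[ℝ] F} {p : E} (hΨ : ContDiff ℝ ∞ Ψ) (hp : HasFDerivAt Ψ (Ψ' : E →L[ℝ] F) p) :
    ∃ Θ : F → E, ContDiff ℝ ∞ Θ ∧ (∀ᶠ x in 𝓝 p, Θ (Ψ x) = x) ∧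
      ∀ᶠ y in 𝓝 (Ψ p), Ψ (Θ y) = y := by
  let e := hΨ.contDiffAt.toOpenPartialHomeomorph Ψ hp (by simp)
  have hps : p ∈ e.source := hΨ.contDiffAt.mem_toOpenPartialHomeomorph_source hp (by simp)
  have hpt : Ψ p ∈ e.target := e.map_source hps
  have hinv : ∀ᶠ x in 𝓝 p, ∃ L : E ≃L[ℝ] F, (L : E →L[ℝ] F) = fderiv ℝ Ψ x :=
    (hΨ.continuous_fderiv (by simp)).continuousAt.eventually_mem
      (hp.fderiv ▸ ContinuousLinearEquiv.nhds Ψ')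
  have hsymm_p : e.symm (Ψ p) = p := e.left_inv hps
  have htend : Filter.Tendsto e.symm (𝓝 (Ψ p)) (𝓝 p) := by
    simpa only [hsymm_p] using (e.continuousAt_symm hpt).tendsto
  have hsymm : ∀ᶠ y in 𝓝 (Ψ p), ContDiffAt ℝ ∞ e.symm y := by
    filter_upwards [htend.eventually hinv, e.open_target.mem_nhds hpt] with y ⟨L, hL⟩ hy
    refine e.contDiffAt_symm hy (f₀' := L) ?_ hΨ.contDiffAt
    rw [hL]
    exact (hΨ.differentiable (by simp) _).hasFDerivAt
  obtain ⟨Θ, hΘ, hΘe⟩ := exists_contDiff_eventuallyEq hsymm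
  refine ⟨Θ, hΘ, ?_, ?_⟩
  · filter_upwards [hΨ.continuous.continuousAt.eventually hΘe, e.open_source.mem_nhds hps]
      with x hx hxs
    exact hx.trans (e.left_inv hxs)
  · filter_upwards [hΘe, e.open_target.mem_nhds hpt] with y hy hyt
    exact hy ▸ e.right_inv hyt

theorem exists_contDiff_straightening {ρ : E → ℝ} (hρ : ContDiff ℝ ∞ ρ) {p : E}
    (hdρ : fderiv ℝ ρ p ≠ 0) :
    ∃ (ℓ : E →L[ℝ] ℝ) (v : E) (Ψ Θ : E → E), ℓ v = 1 ∧ ContDiff ℝ ∞ Ψ ∧ ContDiff ℝ ∞ Θ ∧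
      (∀ x, ℓ (Ψ x) = ρ x) ∧ (∀ᶠ x in 𝓝 p, Θ (Ψ x) = x) ∧ ∀ᶠ y in 𝓝 (Ψ p), Ψ (Θ y) = y := by
  set ℓ := fderiv ℝ ρ p
  obtain ⟨v, hv⟩ : ∃ v, ℓ v = 1 := by
    obtain ⟨v₀, hv₀⟩ := DFunLike.ne_iff.1 hdρ
    exact ⟨(ℓ v₀)⁻¹ • v₀, by simpa using inv_mul_cancel₀ hv₀⟩
  let Ψ : E → E := fun x => x + (ρ x - ℓ x) • v
  have hΨ : ContDiff ℝ ∞ Ψ := contDiff_id.add ((hρ.sub ℓ.contDiff).smul contDiff_const)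
  have hΨ' : HasFDerivAt Ψ (ContinuousLinearEquiv.refl ℝ E : E →L[ℝ] E) p := by
    have hρ' : HasFDerivAt ρ ℓ p := (hρ.differentiable (by simp) p).hasFDerivAt
    simpa [Ψ] using! (hasFDerivAt_id p).add ((hρ'.sub ℓ.hasFDerivAt).smul_const v)
  obtain ⟨Θ, hΘ, hleft, hright⟩ := exists_contDiff_localInverse hΨ hΨ'
  exact ⟨ℓ, v, Ψ, Θ, hv, hΨ, hΘ, fun x => by simp [Ψ, hv], hleft, hright⟩

theorem exists_contDiff_eventuallyEq_smul [CompleteSpace F] {ρ : E → ℝ} {H : E → F} {p : E}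
    (hρ : ContDiff ℝ ∞ ρ) (hH : ContDiff ℝ ∞ H) (hp : ρ p = 0) (hdρ : fderiv ℝ ρ p ≠ 0)
    (hvanish : ∀ᶠ x in 𝓝 p, ρ x = 0 → H x = 0) :
    ∃ G : E → F, ContDiff ℝ ∞ G ∧ H =ᶠ[𝓝 p] fun x => ρ x • G x := by
  obtain ⟨ℓ, v, Ψ, Θ, hv, hΨ, hΘ, hℓΨ, hleft, hright⟩ := exists_contDiff_straightening hρ hdρ
  obtain ⟨Φ, hΦ, hHΦ⟩ := exists_contDiff_sub_eq_apply_sub (hH.comp hΘ)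
  let foot : E → E := fun x => Ψ x - ρ x • v
  have hfoot : ContDiff ℝ ∞ foot := hΨ.sub (hρ.smul contDiff_const)
  have hfoot_p : foot p = Ψ p := by simp [foot, hp]
  have hfoot_tendsto : Filter.Tendsto foot (𝓝 p) (𝓝 (Ψ p)) :=
    hfoot_p ▸ hfoot.continuous.continuousAt
  have hΘ_tendsto : Filter.Tendsto Θ (𝓝 (Ψ p)) (𝓝 p) := by
    simpa only [hleft.self_of_nhds] using hΘ.continuous.tendsto (Ψ p)
  refine ⟨fun x => Φ (foot x, Ψ x) v, (hΦ.comp (hfoot.prodMk hΨ)).clm_apply contDiff_const, ?_⟩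
  filter_upwards [hleft, hfoot_tendsto.eventually hright,
    (hΘ_tendsto.comp hfoot_tendsto).eventually hvanish] with x hx hΨΘ hzero
  have hfoot_zero : H (Θ (foot x)) = 0 :=
    hzero (by simp [← hℓΨ (Θ (foot x)), hΨΘ, foot, hℓΨ, hv])
  simpa [hfoot_zero, hx, foot] using hHΦ (foot x) (Ψ x)

theorem eventuallyEq_zero_of_smul_eventuallyEq_zero {E F : Type*} [NormedAddCommGroup E]
    [NormedSpace ℝ E] [NormedAddCommGroup F] [NormedSpace ℝ F] {ρ : E → ℝ} {K : E → F} {p : E}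
    (hρ : ContDiff ℝ 1 ρ) (hdρ : fderiv ℝ ρ p ≠ 0) (hK : Continuous K)
    (hρK : ∀ᶠ x in 𝓝 p, ρ x • K x = 0) : K =ᶠ[𝓝 p] 0 := by
  have hdρ_near : ∀ᶠ x in 𝓝 p, fderiv ℝ ρ x ≠ 0 :=
    (hρ.continuous_fderiv (by simp)).continuousAt.eventually_ne hdρ
  filter_upwards [hdρ_near, hρK.eventually_nhds] with x hx hρKx
  by_contra hKx
  have hρx : ρ =ᶠ[𝓝 x] fun _ => 0 := by
    filter_upwards [hρKx, hK.continuousAt.eventually_ne hKx] with y hy hKy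
    exact (smul_eq_zero.1 hy).resolve_right hKy
  exact hx (by simp [hρx.fderiv_eq])

end SmoothDivision

section Commutators

variable {R B : Type*} [CommRing R] [Ring B] [Algebra R B]

theorem pow_succ_mul_of_mul_eq_mul_add {D x y : B} (hx : D * x = x * D + y) (hy : Commute D y)
    (k : ℕ) : D ^ (k + 1) * x = x * D ^ (k + 1) + (k + 1) • (y * D ^ k) := by
  induction k with
  | zero => simp [hx]
  | succ k ih =>
    calc D ^ (k + 2) * x = D * (D ^ (k + 1) * x) := by rw [pow_succ' D (k + 1), mul_assoc]
      _ = D * x * D ^ (k + 1) + (k + 1) • (D * y * D ^ k) := by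
        rw [ih, mul_add, mul_smul_comm, mul_assoc, mul_assoc]
      _ = x * D ^ (k + 2) + (y * D ^ (k + 1) + (k + 1) • (y * D ^ (k + 1))) := by
        rw [hx, hy.eq, add_mul, mul_assoc x, ← pow_succ', mul_assoc y, ← pow_succ', add_assoc]
      _ = x * D ^ (k + 2) + (k + 2) • (y * D ^ (k + 1)) := by rw [← succ_nsmul']

theorem mul_pow_of_mul_eq_mul_add_smul {D h : B} {c : R} (hh : h * D = D * h + c • D) (k : ℕ) :
    h * D ^ k = D ^ k * (h + (k * c) • 1) := by
  induction k with
  | zero => simp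
  | succ k ih =>
    calc h * D ^ (k + 1) = D ^ k * (h * D + (k * c) • D) := by
          rw [pow_succ, ← mul_assoc, ih, mul_assoc, add_mul, smul_mul_assoc, one_mul]
      _ = D ^ k * (D * (h + ((k + 1 : ℕ) * c) • 1)) := by
          rw [hh, mul_add D, mul_smul_comm, mul_one, add_assoc, ← add_smul, Nat.cast_succ,
            add_one_mul, add_comm c]
      _ = D ^ (k + 1) * (h + ((k + 1 : ℕ) * c) • 1) := by rw [pow_succ, mul_assoc]

theorem pow_succ_mul_of_mul_eq_mul_add_smul {D r h : B} {c : R} (hr : D * r = r * D + h)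
    (hh : h * D = D * h + (2 * c) • D) (k : ℕ) :
    D ^ (k + 1) * r = r * D ^ (k + 1) + (k + 1) • (D ^ k * (h + (k * c) • 1)) := by
  induction k with
  | zero => simp [hr]
  | succ k ih =>
    have hsum : (h + ((k + 1 : ℕ) * (2 * c)) • 1) + (k + 1) • (h + (k * c) • 1) =
        (k + 2) • (h + ((k + 1 : ℕ) * c) • (1 : B)) := by
      push_cast
      module
    calc D ^ (k + 2) * r = D * (D ^ (k + 1) * r) := by rw [pow_succ' D (k + 1), mul_assoc]
      _ = D * r * D ^ (k + 1) + (k + 1) • (D ^ (k + 1) * (h + (k * c) • 1)) := by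
        rw [ih, mul_add, mul_smul_comm, ← mul_assoc, ← mul_assoc, ← pow_succ']
      _ = r * D ^ (k + 2) + (D ^ (k + 1) * (h + ((k + 1 : ℕ) * (2 * c)) • 1) +
            (k + 1) • (D ^ (k + 1) * (h + (k * c) • 1))) := by
        rw [hr, add_mul, mul_assoc r, ← pow_succ', mul_pow_of_mul_eq_mul_add_smul hh, add_assoc]
      _ = r * D ^ (k + 2) + (k + 2) • (D ^ (k + 1) * (h + ((k + 1 : ℕ) * c) • 1)) := by
        rw [← mul_smul_comm, ← mul_add, hsum, mul_smul_comm]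

end Commutators

/-- The algebraic part of Wirtinger calculus on `C^∞(ℂ^ι; ℂ)`: coordinates `z i`, `zbar i` in a
commutative algebra, with commuting derivations `d i = ∂/∂z_i`, `dbar i = ∂/∂z̄_i` dual to them. -/
structure WirtingerCalculus (R A ι : Type*) [CommRing R] [CommRing A] [Algebra R A]
    [DecidableEq ι] where
  z : ι → A
  zbar : ι → A
  d : ι → Derivation R A A
  dbar : ι → Derivation R A A
  d_z (i j : ι) : d i (z j) = if i = j then 1 else 0
  d_zbar (i j : ι) : d i (zbar j) = 0
  dbar_z (i j : ι) : dbar i (z j) = 0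
  dbar_zbar (i j : ι) : dbar i (zbar j) = if i = j then 1 else 0
  d_d_comm (i j : ι) (f : A) : d i (d j f) = d j (d i f)
  d_dbar_comm (i j : ι) (f : A) : d i (dbar j f) = dbar j (d i f)
  dbar_dbar_comm (i j : ι) (f : A) : dbar i (dbar j f) = dbar j (dbar i f)

namespace WirtingerCalculus

variable {R A ι : Type*} [CommRing R] [CommRing A] [Algebra R A] [DecidableEq ι]
  (C : WirtingerCalculus R A ι)

/-- The calculus with the roles of `z` and `z̄` exchanged. It transfers identities for `∂/∂z_i`
to identities for `∂/∂z̄_i`. -/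
@[simps]
def swap : WirtingerCalculus R A ι where
  z := C.zbar
  zbar := C.z
  d := C.dbar
  dbar := C.d
  d_z := C.dbar_zbar
  d_zbar := C.dbar_z
  dbar_z := C.d_zbar
  dbar_zbar := C.d_z
  d_d_comm := C.dbar_dbar_comm
  d_dbar_comm i j f := (C.d_dbar_comm j i f).symm
  dbar_dbar_comm := C.d_d_comm

variable [Fintype ι] (g : ι → R)

/-- The Euler derivation `∑ z_i ∂/∂z_i`. -/
def euler : Derivation R A A :=
  ∑ i, C.z i • C.d i

/-- The conjugate Euler derivation `∑ z̄_i ∂/∂z̄_i`. -/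
def eulerBar : Derivation R A A :=
  C.swap.euler

/-- The constant coefficient Laplacian `∑ g_i ∂²/∂z_i∂z̄_i`. -/
def laplacian : Module.End R A :=
  ∑ i, g i • ((C.d i : A →ₗ[R] A) * (C.dbar i : A →ₗ[R] A))

/-- The Hermitian form `∑ ε_i z_i z̄_i`. -/
def hermForm (ε : ι → R) : A :=
  ∑ i, ε i • (C.z i * C.zbar i)

theorem euler_apply (f : A) : C.euler f = ∑ i, C.z i * C.d i f := by
  have h := congr_fun (map_sum Derivation.coeFnAddMonoidHom (fun i => C.z i • C.d i) .univ) f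
  rw [Finset.sum_apply] at h
  exact h

theorem eulerBar_apply (f : A) : C.eulerBar f = ∑ i, C.zbar i * C.dbar i f :=
  C.swap.euler_apply f

theorem laplacian_apply (f : A) : C.laplacian g f = ∑ i, g i • C.d i (C.dbar i f) := by
  simp [laplacian]

theorem laplacian_swap : C.swap.laplacian g = C.laplacian g := by
  ext f
  simp [laplacian_apply, C.d_dbar_comm]

theorem hermForm_swap (ε : ι → R) : C.swap.hermForm ε = C.hermForm ε := by
  simp [hermForm, mul_comm]

theorem d_laplacian (i : ι) (f : A) : C.d i (C.laplacian g f) = C.laplacian g (C.d i f) := by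
  simp [laplacian_apply, C.d_d_comm i, C.d_dbar_comm i]

theorem dbar_laplacian (i : ι) (f : A) :
    C.dbar i (C.laplacian g f) = C.laplacian g (C.dbar i f) := by
  simpa only [laplacian_swap, swap_d] using C.swap.d_laplacian g i f

theorem laplacian_z_mul (i : ι) (f : A) :
    C.laplacian g (C.z i * f) = C.z i * C.laplacian g f + g i • C.dbar i f := by
  simp [laplacian_apply, C.d_z, C.dbar_z, Finset.mul_sum, Finset.sum_add_distrib]

theorem laplacian_zbar_mul (i : ι) (f : A) :
    C.laplacian g (C.zbar i * f) = C.zbar i * C.laplacian g f + g i • C.d i f := by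
  simpa only [laplacian_swap, swap_z, swap_dbar] using C.swap.laplacian_z_mul g i f

theorem laplacian_euler (f : A) :
    C.laplacian g (C.euler f) = C.euler (C.laplacian g f) + C.laplacian g f := by
  simp only [euler_apply, map_sum, laplacian_z_mul, Finset.sum_add_distrib, d_laplacian]
  rw [C.laplacian_apply g f]
  simp only [C.d_dbar_comm]

theorem laplacian_eulerBar (f : A) :
    C.laplacian g (C.eulerBar f) = C.eulerBar (C.laplacian g f) + C.laplacian g f := by
  simpa only [eulerBar, laplacian_swap] using C.swap.laplacian_euler g f

theorem euler_z (i : ι) : C.euler (C.z i) = C.z i := by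
  simp [euler_apply, C.d_z]

theorem euler_zbar (i : ι) : C.euler (C.zbar i) = 0 := by
  simp [euler_apply, C.d_zbar]

theorem eulerBar_z (i : ι) : C.eulerBar (C.z i) = 0 :=
  C.swap.euler_zbar i

theorem euler_hermForm (ε : ι → R) : C.euler (C.hermForm ε) = C.hermForm ε := by
  simp [hermForm, euler_z, euler_zbar, mul_comm]

theorem eulerBar_hermForm (ε : ι → R) : C.eulerBar (C.hermForm ε) = C.hermForm ε := by
  simpa only [eulerBar, hermForm_swap] using C.swap.euler_hermForm ε

theorem laplacian_hermForm_mul {ε : ι → R} {c : R} (hε : ∀ i, ε i * g i = c) (f : A) :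
    C.laplacian g (C.hermForm ε * f) = C.hermForm ε * C.laplacian g f +
      c • (C.euler f + C.eulerBar f + (Fintype.card ι : R) • f) := by
  have hterm (i : ι) : C.laplacian g (ε i • (C.z i * C.zbar i) * f) =
      ε i • (C.z i * C.zbar i) * C.laplacian g f +
        c • (C.z i * C.d i f + C.zbar i * C.dbar i f + f) := by
    rw [smul_mul_assoc, map_smul, mul_assoc, laplacian_z_mul, laplacian_zbar_mul,
      Derivation.leibniz, C.dbar_zbar, if_pos rfl, ← hε i]
    simp only [smul_eq_mul, mul_one, mul_add, mul_smul_comm, smul_mul_assoc, mul_assoc]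
    module
  simp only [hermForm, Finset.sum_mul, map_sum, hterm, Finset.sum_add_distrib, ← Finset.smul_sum,
    euler_apply, eulerBar_apply, Finset.sum_const, Finset.card_univ, Nat.cast_smul_eq_nsmul]

theorem laplacian_pow_succ_z_mul (i : ι) (k : ℕ) (f : A) :
    (C.laplacian g ^ (k + 1)) (C.z i * f) = C.z i * (C.laplacian g ^ (k + 1)) f +
      (k + 1) • g i • C.dbar i ((C.laplacian g ^ k) f) := by
  have hcomm : C.laplacian g * LinearMap.mulLeft R (C.z i) =
      LinearMap.mulLeft R (C.z i) * C.laplacian g + g i • (C.dbar i : A →ₗ[R] A) :=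
    LinearMap.ext (C.laplacian_z_mul g i)
  have hdbar : Commute (C.laplacian g) (g i • (C.dbar i : A →ₗ[R] A)) :=
    Commute.smul_right (LinearMap.ext fun f => (C.dbar_laplacian g i f).symm) _
  exact congr($(pow_succ_mul_of_mul_eq_mul_add hcomm hdbar k) f)

theorem eulerBar_laplacian_pow (k : ℕ) (f : A) :
    C.eulerBar ((C.laplacian g ^ k) f) =
      (C.laplacian g ^ k) (C.eulerBar f) - k • (C.laplacian g ^ k) f := by
  cases k with
  | zero => simp
  | succ k =>
    have hcomm : C.laplacian g * (C.eulerBar : A →ₗ[R] A) =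
        (C.eulerBar : A →ₗ[R] A) * C.laplacian g + C.laplacian g :=
      LinearMap.ext (C.laplacian_eulerBar g)
    have hpow := pow_succ_mul_of_mul_eq_mul_add hcomm (Commute.refl _) k
    rw [← pow_succ'] at hpow
    exact eq_sub_of_add_eq congr($hpow.symm f)

theorem laplacian_pow_succ_hermForm_mul {ε : ι → R} {c : R} (hε : ∀ i, ε i * g i = c) (k : ℕ)
    (f : A) :
    (C.laplacian g ^ (k + 1)) (C.hermForm ε * f) = C.hermForm ε * (C.laplacian g ^ (k + 1)) f +
      (k + 1) • (C.laplacian g ^ k)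
        (c • (C.euler f + C.eulerBar f + ((Fintype.card ι : R) - k) • f)) := by
  let h : Module.End R A := c • ((C.euler : A →ₗ[R] A) + (C.eulerBar : A →ₗ[R] A) +
    (Fintype.card ι : R) • 1)
  have hcomm : C.laplacian g * LinearMap.mulLeft R (C.hermForm ε) =
      LinearMap.mulLeft R (C.hermForm ε) * C.laplacian g + h :=
    LinearMap.ext (C.laplacian_hermForm_mul g hε)
  have hh : h * C.laplacian g = C.laplacian g * h + (2 * -c) • C.laplacian g := by
    ext f
    simp only [h, Module.End.mul_apply, LinearMap.smul_apply, LinearMap.add_apply,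
      Derivation.coeFn_coe, Module.End.one_apply, map_smul, map_add, laplacian_euler,
      laplacian_eulerBar]
    module
  have hpow := congr($(pow_succ_mul_of_mul_eq_mul_add_smul hcomm hh k) f)
  have harg : (h + ((k : R) * -c) • 1) f =
      c • (C.euler f + C.eulerBar f + ((Fintype.card ι : R) - k) • f) := by
    simp only [h, LinearMap.add_apply, LinearMap.smul_apply, Derivation.coeFn_coe,
      Module.End.one_apply]
    module
  rw [← harg]
  exact hpow

end WirtingerCalculus

section SmoothFunctions

variable {E : Type*} [NormedAddCommGroup E] [NormedSpace ℝ E]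

variable (E) in
/-- The `ℂ`-algebra `C^∞(E; ℂ)`. On it, differential operators are linear endomorphisms, so that
operator identities can be stated and iterated without smoothness side conditions. -/
def smoothFunctions : Subalgebra ℂ (E → ℂ) where
  carrier := {f | ContDiff ℝ ∞ f}
  mul_mem' {f g} (hf : ContDiff ℝ ∞ f) (hg : ContDiff ℝ ∞ g) := hf.mul hg
  add_mem' {f g} (hf : ContDiff ℝ ∞ f) (hg : ContDiff ℝ ∞ g) := hf.add hg
  algebraMap_mem' c := show ContDiff ℝ ∞ fun _ => c from contDiff_const

theorem mem_smoothFunctions {f : E → ℂ} : f ∈ smoothFunctions E ↔ ContDiff ℝ ∞ f :=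
  Iff.rfl

theorem contDiff_coe (f : smoothFunctions E) : ContDiff ℝ ∞ (f : E → ℂ) :=
  mem_smoothFunctions.1 f.2

theorem differentiable_coe (f : smoothFunctions E) : Differentiable ℝ (f : E → ℂ) :=
  (contDiff_coe f).differentiable (by simp)

theorem contDiff_fderiv_coe (f : smoothFunctions E) : ContDiff ℝ ∞ (fderiv ℝ (f : E → ℂ)) :=
  (contDiff_coe f).fderiv_right (by simp)

/-- The derivation of `C^∞(E; ℂ)` that differentiates in the constant direction `v`. -/
def dirDeriv (v : E) : Derivation ℂ (smoothFunctions E) (smoothFunctions E) :=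
  Derivation.mk'
    { toFun f := ⟨fun x => fderiv ℝ (f : E → ℂ) x v,
        mem_smoothFunctions.2 ((contDiff_fderiv_coe f).clm_apply contDiff_const)⟩
      map_add' f g := by
        ext x
        simp [fderiv_add (differentiable_coe f x) (differentiable_coe g x)]
      map_smul' c f := by
        ext x
        simp [fderiv_const_smul (differentiable_coe f x)] }
    fun f g => by
      ext x
      simp [fderiv_mul (differentiable_coe f x) (differentiable_coe g x)]

theorem coe_dirDeriv (v : E) (f : smoothFunctions E) :
    (dirDeriv v f : E → ℂ) = fun x => fderiv ℝ (f : E → ℂ) x v :=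
  rfl

theorem dirDeriv_comm (v w : E) (f : smoothFunctions E) :
    dirDeriv v (dirDeriv w f) = dirDeriv w (dirDeriv v f) := by
  have hsnd (v w x : E) : (dirDeriv v (dirDeriv w f) : E → ℂ) x =
      fderiv ℝ (fderiv ℝ (f : E → ℂ)) x v w := by
    have h := fderiv_clm_apply ((contDiff_fderiv_coe f).differentiable (by simp) x)
      (differentiableAt_const w)
    simpa [coe_dirDeriv] using congr($h v)
  have hsymm (x : E) : IsSymmSndFDerivAt ℝ (f : E → ℂ) x :=
    (contDiff_infty.1 (contDiff_coe f) 2).contDiffAt.isSymmSndFDerivAt (by simp)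
  ext x
  rw [hsnd, hsnd, (hsymm x).eq v w]

/-- A real-linear functional as an element of `C^∞(E; ℂ)`. -/
def linearFn (L : E →L[ℝ] ℂ) : smoothFunctions E :=
  ⟨L, mem_smoothFunctions.2 L.contDiff⟩

theorem dirDeriv_linearFn (v : E) (L : E →L[ℝ] ℂ) :
    dirDeriv v (linearFn L) = algebraMap ℂ _ (L v) := by
  ext x
  simp [coe_dirDeriv, linearFn]

end SmoothFunctions

section Wirtinger

variable {ι : Type*} [Fintype ι]

/-- The coordinate `ζ_i` as an element of `C^∞(ℂ^ι; ℂ)`. -/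
def coordFn (i : ι) : smoothFunctions (ι → ℂ) :=
  linearFn (ContinuousLinearMap.proj i)

/-- The conjugate coordinate `ζ̄_i` as an element of `C^∞(ℂ^ι; ℂ)`. -/
def conjCoordFn (i : ι) : smoothFunctions (ι → ℂ) :=
  linearFn ((Complex.conjCLE : ℂ →L[ℝ] ℂ).comp (ContinuousLinearMap.proj i))

variable [DecidableEq ι]

/-- The derivation `(∂/∂x_i + s ∂/∂y_i) / 2` of `C^∞(ℂ^ι; ℂ)`, where `ζ_i = x_i + √-1 y_i`: this is
`∂/∂ζ_i` for `s = -√-1` and `∂/∂ζ̄_i` for `s = √-1`. -/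
def wirtinger (s : ℂ) (i : ι) :
    Derivation ℂ (smoothFunctions (ι → ℂ)) (smoothFunctions (ι → ℂ)) :=
  (1 / 2 : ℂ) • (dirDeriv (E := ι → ℂ) (Pi.single i 1) +
    s • dirDeriv (E := ι → ℂ) (Pi.single i Complex.I))

theorem wirtinger_apply (s : ℂ) (i : ι) (f : smoothFunctions (ι → ℂ)) :
    wirtinger s i f = (1 / 2 : ℂ) • (dirDeriv (E := ι → ℂ) (Pi.single i 1) f +
      s • dirDeriv (E := ι → ℂ) (Pi.single i Complex.I) f) :=
  rfl

theorem wirtinger_comm (s t : ℂ) (i j : ι) (f : smoothFunctions (ι → ℂ)) :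
    wirtinger s i (wirtinger t j f) = wirtinger t j (wirtinger s i f) := by
  simp only [wirtinger_apply, Derivation.map_smul, Derivation.map_add]
  have hcomm (v w : ι → ℂ) := dirDeriv_comm v w f
  rw [hcomm (Pi.single i 1), hcomm (Pi.single i 1), hcomm (Pi.single i Complex.I),
    hcomm (Pi.single i Complex.I)]
  module

theorem wirtinger_linearFn (s : ℂ) (i : ι) (L : (ι → ℂ) →L[ℝ] ℂ) :
    wirtinger s i (linearFn L) = algebraMap ℂ _
      ((1 / 2) * (L (Pi.single i 1) + s * L (Pi.single i Complex.I))) := by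
  simp [wirtinger_apply, dirDeriv_linearFn, Algebra.smul_def, mul_add]

variable (ι) in
/-- Wirtinger calculus on `C^∞(ℂ^ι; ℂ)`. -/
def smoothCalculus : WirtingerCalculus ℂ (smoothFunctions (ι → ℂ)) ι where
  z := coordFn
  zbar := conjCoordFn
  d := wirtinger (-Complex.I)
  dbar := wirtinger Complex.I
  d_z i j := by
    rw [coordFn, wirtinger_linearFn]
    ext ζ
    split_ifs with h
    · norm_num [h]
    · norm_num [Ne.symm h]
  d_zbar i j := by
    rw [conjCoordFn, wirtinger_linearFn]
    obtain rfl | h := eq_or_ne j i <;> simp [*]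
  dbar_z i j := by
    rw [coordFn, wirtinger_linearFn]
    obtain rfl | h := eq_or_ne j i <;> simp [*]
  dbar_zbar i j := by
    rw [conjCoordFn, wirtinger_linearFn]
    ext ζ
    split_ifs with h
    · norm_num [h]
    · norm_num [Ne.symm h]
  d_d_comm := wirtinger_comm _ _
  d_dbar_comm := wirtinger_comm _ _
  dbar_dbar_comm := wirtinger_comm _ _

end Wirtinger

variable {n : ℕ}

section Germs

variable {F G : Amb n → ℂ} {ζ : Amb n}

theorem eventuallyEq_dζ (h : F =ᶠ[𝓝 ζ] G) (i : Fin (n + 2)) : dζ i F =ᶠ[𝓝 ζ] dζ i G := by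
  filter_upwards [h.fderiv (𝕜 := ℝ)] with η hη
  simp only [dζ, hη]

theorem eventuallyEq_dζbar (h : F =ᶠ[𝓝 ζ] G) (i : Fin (n + 2)) :
    dζbar i F =ᶠ[𝓝 ζ] dζbar i G := by
  filter_upwards [h.fderiv (𝕜 := ℝ)] with η hη
  simp only [dζbar, hη]

theorem eventuallyEq_ambLaplacian (h : F =ᶠ[𝓝 ζ] G) : ambLaplacian F =ᶠ[𝓝 ζ] ambLaplacian G := by
  have hsnd (i : Fin (n + 2)) := eventuallyEq_dζ (eventuallyEq_dζbar h i) i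
  filter_upwards [Filter.eventually_all.2 hsnd] with η hη
  simp only [ambLaplacian, hη]

theorem eventuallyEq_ambLaplacian_iterate (h : F =ᶠ[𝓝 ζ] G) (k : ℕ) :
    ambLaplacian^[k] F =ᶠ[𝓝 ζ] ambLaplacian^[k] G := by
  induction k generalizing F G with
  | zero => exact h
  | succ _ ih => exact ih (eventuallyEq_ambLaplacian h)

theorem eventuallyEq_eulerZ (h : F =ᶠ[𝓝 ζ] G) : eulerZ F =ᶠ[𝓝 ζ] eulerZ G := by
  filter_upwards [Filter.eventually_all.2 (eventuallyEq_dζ h)] with η hη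
  simp only [eulerZ, hη]

theorem eventuallyEq_eulerZbar (h : F =ᶠ[𝓝 ζ] G) : eulerZbar F =ᶠ[𝓝 ζ] eulerZbar G := by
  filter_upwards [Filter.eventually_all.2 (eventuallyEq_dζbar h)] with η hη
  simp only [eulerZbar, hη]

theorem IsHomogeneousNear.congr {w w' : ℂ} (hF : IsHomogeneousNear w w' F ζ)
    (h : G =ᶠ[𝓝 ζ] F) : IsHomogeneousNear w w' G ζ := by
  filter_upwards [hF, h.eventuallyEq_nhds, eventuallyEq_eulerZ h, eventuallyEq_eulerZbar h]
    with η hη heq hZ hZbar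
  rw [hZ, hZbar, heq.self_of_nhds]
  exact ⟨hη.1.congr_of_eventuallyEq heq, hη.2⟩

end Germs

section HomogeneousCoordinates

theorem homCoord_one_zero (z : Sph n) : homCoord 1 z 0 = 1 :=
  rfl

theorem homCoord_one_succ (z : Sph n) (j : Fin (n + 1)) : homCoord 1 z j.succ = coord j z :=
  one_mul _

theorem sum_norm_sq_coord (z : Sph n) : ∑ j, ‖coord j z‖ ^ 2 = 1 := by
  have h := EuclideanSpace.norm_sq_eq (z : EuclideanSpace ℂ (Fin (n + 1)))
  rw [norm_eq_of_mem_sphere z, one_pow] at h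
  exact h.symm

theorem sum_conj_coord_mul_coord (z : Sph n) : ∑ j, conj (coord j z) * coord j z = 1 := by
  simp only [Complex.conj_mul']
  exact_mod_cast sum_norm_sq_coord z

theorem continuous_homCoord : Continuous fun q : ℂ × Sph n => homCoord q.1 q.2 := by
  refine continuous_pi fun i => Fin.cases continuous_fst (fun j => ?_) i
  have hcoord : Continuous fun z : Sph n => coord j z :=
    (EuclideanSpace.proj j : EuclideanSpace ℂ (Fin (n + 1)) →L[ℂ] ℂ).continuous.comp
      continuous_subtype_val
  exact continuous_fst.mul (hcoord.comp continuous_snd)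

theorem IsAmbientExtension.congr {w w' : ℂ} {f : Sph n → ℂ} {z : Sph n} {F G : Amb n → ℂ}
    (hF : IsAmbientExtension w w' f z F) (h : G =ᶠ[𝓝 (homCoord 1 z)] F) :
    IsAmbientExtension w w' f z G := by
  refine ⟨hF.1.congr h, ?_⟩
  filter_upwards [hF.2, (continuous_homCoord.tendsto (1, z)).eventually h] with q hq heq
  rw [heq, hq]

theorem IsAmbientExtension.exists_smoothFunctions {w w' : ℂ} {f : Sph n → ℂ} {z : Sph n}
    {F : Amb n → ℂ} (hF : IsAmbientExtension w w' f z F) :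
    ∃ G : smoothFunctions (Amb n), (G : Amb n → ℂ) =ᶠ[𝓝 (homCoord 1 z)] F := by
  obtain ⟨G, hG, hGF⟩ := exists_contDiff_eventuallyEq (hF.1.mono fun _ => And.left)
  exact ⟨⟨G, hG⟩, hGF⟩

end HomogeneousCoordinates

section Calculus

/-- The signs `(-1, 1, …, 1)` of the flat Lorentz-Kähler metric. -/
def lorentzSign (n : ℕ) : Fin (n + 2) → ℂ :=
  Fin.cons (-1) fun _ => 1

variable (n) in
/-- Wirtinger calculus on the ambient space. -/
abbrev ambCalculus : WirtingerCalculus ℂ (smoothFunctions (Amb n)) (Fin (n + 2)) :=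
  smoothCalculus (Fin (n + 2))

variable (n) in
/-- `ambLaplacian` as an endomorphism of `C^∞(ℂ^{n+2}; ℂ)`. -/
abbrev smoothLaplacian : Module.End ℂ (smoothFunctions (Amb n)) :=
  (ambCalculus n).laplacian fun i => -2 * lorentzSign n i

variable (F : smoothFunctions (Amb n))

theorem coe_d (i : Fin (n + 2)) : ((ambCalculus n).d i F : Amb n → ℂ) = dζ i F := by
  ext ζ
  change (1 / 2) * (_ + -Complex.I * _) = _
  rw [dζ, neg_mul, ← sub_eq_add_neg]
  rfl

theorem coe_dbar (i : Fin (n + 2)) : ((ambCalculus n).dbar i F : Amb n → ℂ) = dζbar i F :=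
  rfl

theorem coe_euler : ((ambCalculus n).euler F : Amb n → ℂ) = eulerZ F := by
  ext ζ
  rw [WirtingerCalculus.euler_apply]
  simp only [AddSubmonoidClass.coe_finsetSum, MulMemClass.coe_mul, coe_d, Finset.sum_apply,
    Pi.mul_apply, eulerZ]
  rfl

theorem coe_eulerBar : ((ambCalculus n).eulerBar F : Amb n → ℂ) = eulerZbar F := by
  ext ζ
  rw [WirtingerCalculus.eulerBar_apply]
  simp only [AddSubmonoidClass.coe_finsetSum, MulMemClass.coe_mul, coe_dbar, Finset.sum_apply,
    Pi.mul_apply, eulerZbar]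
  rfl

theorem coe_smoothLaplacian : (smoothLaplacian n F : Amb n → ℂ) = ambLaplacian F := by
  ext ζ
  rw [WirtingerCalculus.laplacian_apply, Fin.sum_univ_succ]
  simp [coe_d, coe_dbar, ambLaplacian, lorentzSign, ← Finset.mul_sum, mul_add]

theorem coe_smoothLaplacian_pow (k : ℕ) :
    ((smoothLaplacian n ^ k) F : Amb n → ℂ) = ambLaplacian^[k] F := by
  induction k with
  | zero => rfl
  | succ k ih =>
    rw [pow_succ', Module.End.mul_apply, coe_smoothLaplacian, ih, Function.iterate_succ_apply']

theorem lorentzSign_mul_neg_two_mul (i : Fin (n + 2)) :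
    lorentzSign n i * (-2 * lorentzSign n i) = -2 := by
  refine Fin.cases ?_ (fun j => ?_) i <;> simp [lorentzSign]

end Calculus

section Cone

/-- The function `-|ζ_0|² + ∑_{j ≥ 1} |ζ_j|²`, whose zero set is the null cone. -/
def coneFn (ζ : Amb n) : ℝ :=
  -‖ζ 0‖ ^ 2 + ∑ j : Fin (n + 1), ‖ζ j.succ‖ ^ 2

theorem contDiff_coneFn : ContDiff ℝ ∞ (coneFn (n := n)) := by
  have hsq (i : Fin (n + 2)) : ContDiff ℝ ∞ fun ζ : Amb n => ‖ζ i‖ ^ 2 :=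
    (contDiff_norm_sq ℝ).comp (contDiff_apply ℝ ℂ i)
  exact (hsq 0).neg.add (ContDiff.sum fun j _ => hsq j.succ)

theorem coe_hermForm (ζ : Amb n) :
    ((ambCalculus n).hermForm (lorentzSign n) : Amb n → ℂ) ζ = coneFn ζ := by
  have hsq (i : Fin (n + 2)) : (((ambCalculus n).z i * (ambCalculus n).zbar i :
      smoothFunctions (Amb n)) : Amb n → ℂ) ζ = (‖ζ i‖ ^ 2 : ℝ) := by
    rw [Complex.ofReal_pow, ← Complex.mul_conj']
    rfl
  simp only [WirtingerCalculus.hermForm, AddSubmonoidClass.coe_finsetSum, Finset.sum_apply,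
    SetLike.val_smul, Pi.smul_apply, hsq]
  simp [coneFn, lorentzSign, Fin.sum_univ_succ]

theorem coneFn_homCoord_one (z : Sph n) : coneFn (homCoord 1 z) = 0 := by
  simp only [coneFn, homCoord_one_zero, homCoord_one_succ, sum_norm_sq_coord]
  simp

theorem fderiv_coneFn_homCoord_one_ne_zero (z : Sph n) :
    fderiv ℝ coneFn (homCoord 1 z) ≠ 0 := by
  have hline (t : ℝ) : coneFn (homCoord 1 z + t • (Pi.single 0 1 : Amb n)) = -(1 + t) ^ 2 + 1 := by
    have hzero : (1 : ℂ) + t = ((1 + t : ℝ) : ℂ) := by push_cast; rfl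
    simp [coneFn, homCoord_one_zero, homCoord_one_succ, sum_norm_sq_coord, hzero,
      -Complex.ofReal_add]
  have hderiv : fderiv ℝ coneFn (homCoord 1 z) (Pi.single 0 1) = -2 := by
    have hparabola : HasDerivAt (fun t : ℝ => -(1 + t) ^ 2 + 1) (-2) 0 := by
      simpa using ((((hasDerivAt_id (0 : ℝ)).const_add 1).pow 2).neg.add_const 1)
    rw [← (contDiff_coneFn.differentiable (by simp) _).lineDeriv_eq_fderiv, lineDeriv]
    simpa only [hline] using hparabola.deriv
  intro h
  norm_num [h] at hderiv

end Cone

section RadialProjection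

/-- The Euclidean space `ℂ^{n+1}` that contains the sphere. -/
abbrev Euc (n : ℕ) : Type := EuclideanSpace ℂ (Fin (n + 1))

theorem inv_norm_smul_mem_sphere {x : Euc n} (hx : x ≠ 0) :
    ‖x‖⁻¹ • x ∈ Metric.sphere (0 : Euc n) 1 := by
  rw [mem_sphere_zero_iff_norm, norm_smul, norm_inv, norm_norm,
    inv_mul_cancel₀ (norm_ne_zero_iff.2 hx)]

open Classical in
/-- The radial projection onto the sphere, with the junk value `z` at the origin. -/
def sphProj (z : Sph n) (x : Euc n) : Sph n :=
  if h : x = 0 then z else ⟨‖x‖⁻¹ • x, inv_norm_smul_mem_sphere h⟩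

theorem coe_sphProj (z : Sph n) {x : Euc n} (hx : x ≠ 0) : (sphProj z x : Euc n) = ‖x‖⁻¹ • x := by
  simp [sphProj, hx]

theorem coe_sphProj_of_norm_eq_one (z : Sph n) {x : Euc n} (hx : ‖x‖ = 1) :
    (sphProj z x : Euc n) = x := by
  rw [coe_sphProj z (norm_ne_zero_iff.1 (hx ▸ one_ne_zero)), hx, inv_one, one_smul]

theorem sphProj_coe (z y : Sph n) : sphProj z y = y :=
  Subtype.ext (coe_sphProj_of_norm_eq_one z (norm_eq_of_mem_sphere y))

theorem contMDiffAt_sphProj (z : Sph n) {x : Euc n} (hx : x ≠ 0) :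
    ContMDiffAt 𝓘(ℝ, Euc n) (𝓡 (2 * n + 1)) ∞ (sphProj z) x := by
  let V : TopologicalSpace.Opens (Euc n) := ⟨{0}ᶜ, isOpen_compl_singleton⟩
  have hsmooth : ContMDiff 𝓘(ℝ, Euc n) 𝓘(ℝ, Euc n) ∞
      fun y : V => ‖(y : Euc n)‖⁻¹ • (y : Euc n) := by
    intro y
    have hy : (y : Euc n) ≠ 0 := y.2
    refine (contMDiffAt_subtype_iff (f := fun y : Euc n => ‖y‖⁻¹ • y)).2 (ContDiffAt.contMDiffAt ?_)
    exact ((contDiffAt_id.norm ℝ hy).inv (norm_ne_zero_iff.2 hy)).smul contDiffAt_id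
  have hrestrict := hsmooth.codRestrict_sphere (n := 2 * n + 1) fun y =>
    inv_norm_smul_mem_sphere y.2
  refine (contMDiffAt_subtype_iff (U := V) (x := ⟨x, hx⟩)).1 ?_
  exact (hrestrict ⟨x, hx⟩).congr_of_eventuallyEq
    (.of_forall fun y => Subtype.ext (coe_sphProj z y.2))

theorem SmoothOnSphere.contDiffAt_comp_sphProj {u : Sph n → ℂ} (hu : SmoothOnSphere n u)
    (z : Sph n) {x : Euc n} (hx : x ≠ 0) : ContDiffAt ℝ ∞ (fun y => u (sphProj z y)) x :=
  ((hu _).comp x (contMDiffAt_sphProj z hx)).contDiffAt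

end RadialProjection

section AffineCoordinates

/-- The affine coordinates `z_j = ζ_j / ζ_0`. -/
def affineCoord (ζ : Amb n) : Euc n :=
  WithLp.toLp 2 fun j => ζ j.succ / ζ 0

theorem contDiffAt_affineCoord {ζ : Amb n} (h : ζ 0 ≠ 0) : ContDiffAt ℝ ∞ affineCoord ζ := by
  have hcoord (i : Fin (n + 2)) : ContDiffAt ℝ ∞ (fun η : Amb n => η i) ζ :=
    (contDiff_apply ℝ ℂ i).contDiffAt
  refine (PiLp.continuousLinearEquiv 2 ℝ fun _ : Fin (n + 1) => ℂ).symm.contDiff.contDiffAt.comp ζ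
    (contDiffAt_pi.2 fun j => ?_)
  simp only [div_eq_mul_inv]
  exact (hcoord j.succ).mul ((hcoord 0).inv h)

theorem affineCoord_homCoord {z₀ : ℂ} (h : z₀ ≠ 0) (z : Sph n) :
    affineCoord (homCoord z₀ z) = z := by
  ext j
  simp [affineCoord, homCoord, coord, h]

theorem affineCoord_smul {a : ℂ} (ha : a ≠ 0) (ζ : Amb n) :
    affineCoord (a • ζ) = affineCoord ζ := by
  ext j
  simp [affineCoord, mul_div_mul_left _ _ ha]

theorem norm_affineCoord_eq_one {ζ : Amb n} (h : ζ 0 ≠ 0) (hcone : coneFn ζ = 0) :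
    ‖affineCoord ζ‖ = 1 := by
  have hsum : ∑ j : Fin (n + 1), ‖ζ j.succ‖ ^ 2 = ‖ζ 0‖ ^ 2 := by
    rw [coneFn] at hcone
    linarith
  have hsq : ‖affineCoord ζ‖ ^ 2 = 1 := by
    simp [EuclideanSpace.norm_sq_eq, affineCoord, div_pow, ← Finset.sum_div, hsum, h]
  exact (pow_eq_one_iff_of_nonneg (norm_nonneg _) two_ne_zero).1 hsq

theorem homCoord_sphProj_affineCoord (z : Sph n) {ζ : Amb n} (h : ζ 0 ≠ 0)
    (hcone : coneFn ζ = 0) : homCoord (ζ 0) (sphProj z (affineCoord ζ)) = ζ := by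
  have hproj := coe_sphProj_of_norm_eq_one z (norm_affineCoord_eq_one h hcone)
  funext i
  refine Fin.cases rfl (fun j => ?_) i
  simp only [homCoord, Fin.cons_succ, coord, hproj]
  exact mul_div_cancel₀ _ h

theorem tendsto_sphProj_affineCoord (z : Sph n) :
    Filter.Tendsto (fun ζ => sphProj z (affineCoord ζ)) (𝓝 (homCoord 1 z)) (𝓝 z) := by
  have hcoord : affineCoord (homCoord 1 z) = z := affineCoord_homCoord one_ne_zero z
  have hproj : ContinuousAt (sphProj z) (affineCoord (homCoord 1 z)) := by
    rw [hcoord]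
    exact (contMDiffAt_sphProj z (ne_zero_of_mem_unit_sphere z)).continuousAt
  have h := (hproj.comp (contDiffAt_affineCoord one_ne_zero).continuousAt).tendsto
  rwa [Function.comp_apply, hcoord, sphProj_coe] at h

theorem eventually_coneFn_eq_zero_imp {z : Sph n} {p : Amb n → Prop}
    (h : ∀ᶠ q : ℂ × Sph n in 𝓝 (1, z), p (homCoord q.1 q.2)) :
    ∀ᶠ ζ in 𝓝 (homCoord 1 z), coneFn ζ = 0 → p ζ := by
  have hzero : ContinuousAt (fun ζ : Amb n => ζ 0) (homCoord 1 z) :=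
    (continuous_apply 0).continuousAt
  filter_upwards [(hzero.tendsto.prodMk_nhds (tendsto_sphProj_affineCoord z)).eventually h,
    hzero.eventually_ne one_ne_zero] with ζ hp hne hcone
  rwa [homCoord_sphProj_affineCoord z hne hcone] at hp

end AffineCoordinates

section Independence

theorem isHomogeneousNear_coe_iff {w w' : ℂ} {F : smoothFunctions (Amb n)} {ζ : Amb n} :
    IsHomogeneousNear w w' F ζ ↔
      ((ambCalculus n).euler F : Amb n → ℂ) =ᶠ[𝓝 ζ] (w • F : smoothFunctions (Amb n)) ∧
      ((ambCalculus n).eulerBar F : Amb n → ℂ) =ᶠ[𝓝 ζ] (w' • F : smoothFunctions (Amb n)) := by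
  simp only [IsHomogeneousNear, (contDiff_coe F).contDiffAt, true_and, Filter.eventually_and,
    coe_euler, coe_eulerBar]
  rfl

/-- The function `-|ζ_0|² + ∑_{j ≥ 1} |ζ_j|²` as an element of `C^∞(ℂ^{n+2}; ℂ)`. -/
abbrev smoothCone (n : ℕ) : smoothFunctions (Amb n) :=
  (ambCalculus n).hermForm (lorentzSign n)

theorem derivation_eventuallyEq_of_smoothCone_mul {z : Sph n} {G : smoothFunctions (Amb n)}
    {D : Derivation ℂ (smoothFunctions (Amb n)) (smoothFunctions (Amb n))}
    (hD : D (smoothCone n) = smoothCone n) {v : ℂ}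
    (h : (D (smoothCone n * G) : Amb n → ℂ) =ᶠ[𝓝 (homCoord 1 z)]
      (v • (smoothCone n * G) : smoothFunctions (Amb n))) :
    (D G : Amb n → ℂ) =ᶠ[𝓝 (homCoord 1 z)] ((v - 1) • G : smoothFunctions (Amb n)) := by
  have hmul : D (smoothCone n * G) - v • (smoothCone n * G) =
      smoothCone n * (D G - (v - 1) • G) := by
    rw [Derivation.leibniz, hD]
    simp only [smul_eq_mul, Algebra.smul_def, map_sub, map_one]
    ring
  have hzero : ∀ᶠ ζ in 𝓝 (homCoord 1 z),
      coneFn ζ • ((D G - (v - 1) • G : smoothFunctions (Amb n)) : Amb n → ℂ) ζ = 0 := by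
    filter_upwards [h] with ζ hζ
    have hζ' := congr_fun (congrArg Subtype.val hmul) ζ
    rw [Complex.real_smul, ← coe_hermForm]
    exact hζ'.symm.trans (sub_eq_zero.2 hζ)
  filter_upwards [eventuallyEq_zero_of_smul_eventuallyEq_zero (contDiff_coneFn.of_le (by simp))
    (fderiv_coneFn_homCoord_one_ne_zero z) (contDiff_coe _).continuous hzero] with ζ hζ
  exact sub_eq_zero.1 hζ

-- The weights make the coefficient `w + w' + n + 1 - k` of `Δ^{k-1} G` vanish.
theorem smoothLaplacian_pow_smoothCone_mul_eq_zero {k : ℕ} {w w' : ℂ}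
    (hk : (k : ℂ) = w + w' + n + 1) {z : Sph n} {G : smoothFunctions (Amb n)}
    (hG : IsHomogeneousNear w w' (smoothCone n * G : smoothFunctions (Amb n)) (homCoord 1 z)) :
    ((smoothLaplacian n ^ k) (smoothCone n * G) : Amb n → ℂ) (homCoord 1 z) = 0 := by
  have hcone : (smoothCone n : Amb n → ℂ) (homCoord 1 z) = 0 := by
    rw [coe_hermForm, coneFn_homCoord_one, Complex.ofReal_zero]
  cases k with
  | zero => exact mul_eq_zero_of_left hcone _
  | succ m =>
    obtain ⟨hZ, hZbar⟩ := isHomogeneousNear_coe_iff.1 hG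
    have hZG := derivation_eventuallyEq_of_smoothCone_mul
      ((ambCalculus n).euler_hermForm _) hZ
    have hZbarG := derivation_eventuallyEq_of_smoothCone_mul
      ((ambCalculus n).eulerBar_hermForm _) hZbar
    set K : smoothFunctions (Amb n) := (-2 : ℂ) • ((ambCalculus n).euler G +
      (ambCalculus n).eulerBar G + ((Fintype.card (Fin (n + 2)) : ℂ) - m) • G) with hK
    have hK_zero : (K : Amb n → ℂ) =ᶠ[𝓝 (homCoord 1 z)] (0 : smoothFunctions (Amb n)) := by
      filter_upwards [hZG, hZbarG] with ζ hζ hζbar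
      simp only [hK, Fintype.card_fin, Nat.cast_add, Nat.cast_ofNat, SetLike.val_smul,
        AddMemClass.coe_add, Pi.smul_apply, Pi.add_apply, hζ, hζbar, smul_eq_mul,
        ZeroMemClass.coe_zero, Pi.zero_apply]
      push_cast at hk
      linear_combination 2 * (G : Amb n → ℂ) ζ * hk
    have hpow_K := (eventuallyEq_ambLaplacian_iterate hK_zero m).self_of_nhds
    rw [← coe_smoothLaplacian_pow, ← coe_smoothLaplacian_pow, map_zero] at hpow_K
    rw [(ambCalculus n).laplacian_pow_succ_hermForm_mul _ lorentzSign_mul_neg_two_mul, ← hK]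
    change (smoothCone n : Amb n → ℂ) _ * _ +
      (m + 1) • ((smoothLaplacian n ^ m) K : Amb n → ℂ) _ = 0
    rw [hcone, zero_mul, zero_add, hpow_K]
    exact smul_zero _

theorem IsAmbientExtension.exists_sub_eventuallyEq_smoothCone_mul {w w' : ℂ} {f : Sph n → ℂ}
    {z : Sph n} {F₁ F₂ : smoothFunctions (Amb n)} (h₁ : IsAmbientExtension w w' f z F₁)
    (h₂ : IsAmbientExtension w w' f z F₂) :
    ∃ G : smoothFunctions (Amb n), ((smoothCone n * G : smoothFunctions (Amb n)) : Amb n → ℂ)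
      =ᶠ[𝓝 (homCoord 1 z)] (F₁ - F₂ : smoothFunctions (Amb n)) := by
  have hvanish : ∀ᶠ ζ in 𝓝 (homCoord 1 z), coneFn ζ = 0 →
      ((F₁ - F₂ : smoothFunctions (Amb n)) : Amb n → ℂ) ζ = 0 := by
    refine eventually_coneFn_eq_zero_imp ?_
    filter_upwards [h₁.2, h₂.2] with q hq₁ hq₂
    exact sub_eq_zero.2 (hq₁.trans hq₂.symm)
  obtain ⟨G, hG, hGeq⟩ := exists_contDiff_eventuallyEq_smul contDiff_coneFn (contDiff_coe _)
    (coneFn_homCoord_one z) (fderiv_coneFn_homCoord_one_ne_zero z) hvanish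
  refine ⟨⟨G, hG⟩, ?_⟩
  filter_upwards [hGeq] with ζ hζ
  rw [hζ, Complex.real_smul, ← coe_hermForm]
  rfl

theorem ambLaplacian_iterate_eq_of_isAmbientExtension {k : ℕ} {w w' : ℂ}
    (hk : (k : ℂ) = w + w' + n + 1) {f : Sph n → ℂ} {z : Sph n} {F₁ F₂ : Amb n → ℂ}
    (h₁ : IsAmbientExtension w w' f z F₁) (h₂ : IsAmbientExtension w w' f z F₂) :
    (ambLaplacian^[k] F₁) (homCoord 1 z) = (ambLaplacian^[k] F₂) (homCoord 1 z) := by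
  obtain ⟨S₁, hS₁⟩ := h₁.exists_smoothFunctions
  obtain ⟨S₂, hS₂⟩ := h₂.exists_smoothFunctions
  have hext₁ := h₁.congr hS₁
  have hext₂ := h₂.congr hS₂
  obtain ⟨G, hG⟩ := hext₁.exists_sub_eventuallyEq_smoothCone_mul hext₂
  have hhom : IsHomogeneousNear w w' (S₁ - S₂ : smoothFunctions (Amb n)) (homCoord 1 z) := by
    obtain ⟨hZ₁, hZbar₁⟩ := isHomogeneousNear_coe_iff.1 hext₁.1
    obtain ⟨hZ₂, hZbar₂⟩ := isHomogeneousNear_coe_iff.1 hext₂.1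
    rw [isHomogeneousNear_coe_iff, map_sub, map_sub, smul_sub, smul_sub]
    exact ⟨hZ₁.sub hZ₂, hZbar₁.sub hZbar₂⟩
  have hdiff : ((smoothLaplacian n ^ k) (S₁ - S₂) : Amb n → ℂ) (homCoord 1 z) = 0 := by
    have hlocal := (eventuallyEq_ambLaplacian_iterate hG k).self_of_nhds
    rw [coe_smoothLaplacian_pow, ← hlocal, ← coe_smoothLaplacian_pow]
    exact smoothLaplacian_pow_smoothCone_mul_eq_zero hk (hhom.congr hG)
  rw [map_sub] at hdiff
  rw [← (eventuallyEq_ambLaplacian_iterate hS₁ k).self_of_nhds,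
    ← (eventuallyEq_ambLaplacian_iterate hS₂ k).self_of_nhds, ← coe_smoothLaplacian_pow,
    ← coe_smoothLaplacian_pow]
  exact sub_eq_zero.1 hdiff

theorem gjms_eq {k : ℕ} {w w' : ℂ} (hk : (k : ℂ) = w + w' + n + 1) {f : Sph n → ℂ} {z : Sph n}
    {F : smoothFunctions (Amb n)} (hF : IsAmbientExtension w w' f z F) :
    gjms n k w w' f z =
      (1 / 2 : ℂ) ^ k * ((smoothLaplacian n ^ k) F : Amb n → ℂ) (homCoord 1 z) := by
  have hex : ∃ F : Amb n → ℂ, IsAmbientExtension w w' f z F := ⟨F, hF⟩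
  rw [gjms, dif_pos hex, ambLaplacian_iterate_eq_of_isAmbientExtension hk hex.choose_spec hF,
    coe_smoothLaplacian_pow]
  simp [bipow]

end Independence

section Existence

theorem apply_eq_sum_re_add_im {ι : Type*} [Fintype ι] [DecidableEq ι] (A : (ι → ℂ) →L[ℝ] ℂ)
    (ζ : ι → ℂ) :
    A ζ = ∑ i, ((ζ i).re * A (Pi.single i 1) + (ζ i).im * A (Pi.single i Complex.I)) := by
  have hζ : ζ = ∑ i, ((ζ i).re • (Pi.single i 1 : ι → ℂ) +
      (ζ i).im • (Pi.single i Complex.I : ι → ℂ)) := by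
    funext j
    rw [Finset.sum_apply, Finset.sum_eq_single j (fun i _ hi => by simp [hi.symm]) (by simp)]
    apply Complex.ext <;> simp
  conv_lhs => rw [hζ]
  simp only [map_sum, map_add, map_smul, Complex.real_smul]

theorem fderiv_apply_smul_self (F : Amb n → ℂ) (ζ : Amb n) (c : ℂ) :
    fderiv ℝ F ζ (c • ζ) = c * eulerZ F ζ + conj c * eulerZbar F ζ := by
  rw [apply_eq_sum_re_add_im, eulerZ, eulerZbar, Finset.mul_sum, Finset.mul_sum,
    ← Finset.sum_add_distrib]
  refine Finset.sum_congr rfl fun i _ => ?_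
  rw [Pi.smul_apply, smul_eq_mul, Complex.re_eq_add_conj, Complex.im_eq_sub_conj, map_mul, dζ,
    dζbar]
  field_simp
  linear_combination (c * ζ i - conj c * conj (ζ i)) *
    fderiv ℝ F ζ (Pi.single i Complex.I) * Complex.I_sq

theorem eulerZ_eq_and_eulerZbar_eq_of_fderiv {w w' : ℂ} {F : Amb n → ℂ} {ζ : Amb n}
    (h : ∀ c : ℂ, fderiv ℝ F ζ (c • ζ) = (w * c + w' * conj c) * F ζ) :
    eulerZ F ζ = w * F ζ ∧ eulerZbar F ζ = w' * F ζ := by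
  have hone := h 1
  have hI := h Complex.I
  simp only [fderiv_apply_smul_self, map_one, Complex.conj_I] at hone hI
  have hdiff : eulerZ F ζ - eulerZbar F ζ = (w - w') * F ζ :=
    mul_left_cancel₀ Complex.I_ne_zero (by linear_combination hI)
  constructor
  · linear_combination (hone + hdiff) / 2
  · linear_combination (hone - hdiff) / 2

theorem eventually_bipow_exp_mul (w w' c : ℂ) {a : ℂ} (ha : a ∈ Complex.slitPlane) :
    ∀ᶠ t : ℝ in 𝓝 0, bipow w w' (Complex.exp (t * c) * a) =
      Complex.exp (t * (w * c + w' * conj c)) * bipow w w' a := by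
  have hcont : ContinuousAt (fun t : ℝ => (t * c + Complex.log a).im) 0 := by fun_prop
  have hzero : ((0 : ℝ) * c + Complex.log a).im = a.arg := by simp [Complex.log_im]
  have harg_lt : a.arg < Real.pi :=
    (Complex.arg_le_pi a).lt_of_ne (Complex.mem_slitPlane_iff_arg.1 ha).1
  filter_upwards [hcont.eventually_const_lt (hzero.symm ▸ Complex.neg_pi_lt_arg a),
    hcont.eventually_lt_const (hzero.symm ▸ harg_lt)] with t hlower hupper
  have hlog : Complex.log (Complex.exp (t * c) * a) = t * c + Complex.log a := by
    rw [← Complex.log_exp hlower hupper.le, Complex.exp_add,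
      Complex.exp_log (Complex.slitPlane_ne_zero ha)]
  rw [bipow, hlog, bipow, ← Complex.exp_add]
  congr 1
  simp only [map_add, map_mul, Complex.conj_ofReal]
  ring

theorem contDiffAt_bipow (w w' : ℂ) {a : ℂ} (ha : a ∈ Complex.slitPlane) :
    ContDiffAt ℝ ∞ (bipow w w') a := by
  have hlog : ContDiffAt ℝ ∞ Complex.log a :=
    (Complex.contDiffAt_log (n := ∞) ha).restrict_scalars ℝ
  have hconj : ContDiffAt ℝ ∞ (fun a => conj (Complex.log a)) a :=
    Complex.conjCLE.contDiff.contDiffAt.comp a hlog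
  have hexp : ContDiff ℝ ∞ Complex.exp :=
    ContDiff.restrict_scalars ℝ (𝕜' := ℂ) Complex.contDiff_exp
  exact hexp.contDiffAt.comp a ((contDiffAt_const.mul hlog).add (contDiffAt_const.mul hconj))

theorem hasDerivAt_exp_ofReal_mul (b : ℂ) :
    HasDerivAt (fun t : ℝ => Complex.exp (t * b)) b 0 := by
  simpa using ((hasDerivAt_id (0 : ℝ)).ofReal_comp.mul_const b).cexp

/-- The function `z_0^w z̄_0^{w'} v(z)` of `ζ`, where `v` is a function of the affine coordinates
`z = (ζ_1 / ζ_0, …, ζ_{n+1} / ζ_0)`. -/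
def homExtension (w w' : ℂ) (v : Euc n → ℂ) (ζ : Amb n) : ℂ :=
  bipow w w' (ζ 0) * v (affineCoord ζ)

variable {w w' : ℂ}

theorem contDiffAt_homExtension {v : Euc n → ℂ} {ζ : Amb n} (hζ : ζ 0 ∈ Complex.slitPlane)
    (hv : ContDiffAt ℝ ∞ v (affineCoord ζ)) : ContDiffAt ℝ ∞ (homExtension w w' v) ζ :=
  ((contDiffAt_bipow w w' hζ).comp ζ (f := fun η : Amb n => η 0)
    (contDiff_apply ℝ ℂ 0).contDiffAt).mul
    (hv.comp ζ (contDiffAt_affineCoord (Complex.slitPlane_ne_zero hζ)))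

-- Differentiate along the curve `t ↦ exp (t c) • ζ`, on which the affine coordinates are constant.
theorem fderiv_homExtension_apply_smul {v : Euc n → ℂ} {ζ : Amb n}
    (hζ : ζ 0 ∈ Complex.slitPlane) (hd : DifferentiableAt ℝ (homExtension w w' v) ζ) (c : ℂ) :
    fderiv ℝ (homExtension w w' v) ζ (c • ζ) =
      (w * c + w' * conj c) * homExtension w w' v ζ := by
  have hcurve : HasDerivAt (fun t : ℝ => Complex.exp (t * c) • ζ) (c • ζ) 0 :=
    (hasDerivAt_exp_ofReal_mul c).smul_const ζ
  have hstart : Complex.exp ((0 : ℝ) * c) • ζ = ζ := by simp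
  have hcomp := HasFDerivAt.comp_hasDerivAt (0 : ℝ) (hstart.symm ▸ hd.hasFDerivAt) hcurve
  rw [hstart] at hcomp
  have hscale := (hasDerivAt_exp_ofReal_mul (w * c + w' * conj c)).mul_const
    (homExtension w w' v ζ)
  refine hcomp.unique (hscale.congr_of_eventuallyEq ?_)
  filter_upwards [eventually_bipow_exp_mul w w' c hζ] with t ht
  simp only [homExtension, Function.comp_apply, Pi.smul_apply, smul_eq_mul, ht,
    affineCoord_smul (Complex.exp_ne_zero _), mul_assoc]

theorem isAmbientExtension_homExtension {u : Sph n → ℂ} (hu : SmoothOnSphere n u) (z : Sph n) :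
    IsAmbientExtension w w' u z (homExtension w w' fun x => u (sphProj z x)) := by
  constructor
  · have hslit : ∀ᶠ η : Amb n in 𝓝 (homCoord 1 z), η 0 ∈ Complex.slitPlane :=
      (continuous_apply 0).continuousAt.eventually_mem
        (Complex.isOpen_slitPlane.mem_nhds Complex.one_mem_slitPlane)
    have hne : ∀ᶠ η : Amb n in 𝓝 (homCoord 1 z), affineCoord η ≠ 0 :=
      (contDiffAt_affineCoord one_ne_zero).continuousAt.eventually_ne
        (affineCoord_homCoord one_ne_zero z ▸ ne_zero_of_mem_unit_sphere z)
    filter_upwards [hslit, hne] with η hη hη_ne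
    have hsmooth := contDiffAt_homExtension (w := w) (w' := w') hη
      (hu.contDiffAt_comp_sphProj z hη_ne)
    exact ⟨hsmooth, eulerZ_eq_and_eulerZbar_eq_of_fderiv
      (fderiv_homExtension_apply_smul hη (hsmooth.differentiableAt (by simp)))⟩
  · have hne : ∀ᶠ q : ℂ × Sph n in 𝓝 (1, z), q.1 ≠ 0 :=
      continuous_fst.continuousAt.eventually_ne one_ne_zero
    filter_upwards [hne] with q hq
    rw [homExtension, affineCoord_homCoord hq, sphProj_coe]
    rfl

variable (w w') in
theorem exists_smoothFunctions_isAmbientExtension {u : Sph n → ℂ} (hu : SmoothOnSphere n u)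
    (z : Sph n) : ∃ F : smoothFunctions (Amb n), IsAmbientExtension w w' u z F := by
  have hext := isAmbientExtension_homExtension (w := w) (w' := w') hu z
  obtain ⟨F, hF⟩ := hext.exists_smoothFunctions
  exact ⟨F, hext.congr hF⟩

end Existence

section Commutator

variable {w w' : ℂ} {u : Sph n → ℂ} {z : Sph n} {G : smoothFunctions (Amb n)}

theorem IsHomogeneousNear.coordFn_mul {ζ : Amb n} (hG : IsHomogeneousNear (w - 1) w' G ζ)
    (i : Fin (n + 2)) :
    IsHomogeneousNear w w' (coordFn i * G : smoothFunctions (Amb n)) ζ := by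
  obtain ⟨hZ, hZbar⟩ := isHomogeneousNear_coe_iff.1 hG
  have heuler : (ambCalculus n).euler (coordFn i * G) =
      coordFn i * (ambCalculus n).euler G + coordFn i * G := by
    have hcoord : (ambCalculus n).euler (coordFn i) = coordFn i := (ambCalculus n).euler_z i
    rw [Derivation.leibniz, hcoord, smul_eq_mul, smul_eq_mul, mul_comm G]
  have heulerBar : (ambCalculus n).eulerBar (coordFn i * G) =
      coordFn i * (ambCalculus n).eulerBar G := by
    have hcoord : (ambCalculus n).eulerBar (coordFn i) = 0 := (ambCalculus n).eulerBar_z i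
    rw [Derivation.leibniz, hcoord, smul_zero, add_zero, smul_eq_mul]
  refine isHomogeneousNear_coe_iff.2 ⟨?_, ?_⟩
  · rw [heuler]
    filter_upwards [hZ] with η hη
    change η i * _ + η i * _ = w * (η i * _)
    rw [hη]
    change η i * ((w - 1) * _) + _ = _
    ring
  · rw [heulerBar]
    filter_upwards [hZbar] with η hη
    change η i * _ = w' * (η i * _)
    rw [hη]
    exact mul_left_comm _ _ _

theorem bipow_eq_mul_bipow_sub_one (w w' : ℂ) {a : ℂ} (ha : a ≠ 0) :
    bipow w w' a = a * bipow (w - 1) w' a := by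
  conv_rhs => rw [← Complex.exp_log ha]
  rw [bipow, bipow, ← Complex.exp_add, Complex.exp_log ha]
  ring_nf

theorem IsAmbientExtension.coordFn_mul {f : Sph n → ℂ}
    (hG : IsAmbientExtension (w - 1) w' u z G) (i : Fin (n + 2))
    (hf : ∀ (z₀ : ℂ) (y : Sph n), homCoord z₀ y i * u y = z₀ * f y) :
    IsAmbientExtension w w' f z (coordFn i * G : smoothFunctions (Amb n)) := by
  refine ⟨hG.1.coordFn_mul i, ?_⟩
  have hne : ∀ᶠ q : ℂ × Sph n in 𝓝 (1, z), q.1 ≠ 0 :=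
    continuous_fst.continuousAt.eventually_ne one_ne_zero
  filter_upwards [hG.2, hne] with q hq hq_ne
  change homCoord q.1 q.2 i * (G : Amb n → ℂ) (homCoord q.1 q.2) = _
  rw [hq, bipow_eq_mul_bipow_sub_one w w' hq_ne]
  linear_combination bipow (w - 1) w' q.1 * hf q.1 q.2

theorem gjms_succ_eq_of_coordFn_mul {m : ℕ} (hm : (m : ℂ) = w - 1 + w' + n + 1)
    (hG : IsAmbientExtension (w - 1) w' u z G) (i : Fin (n + 2)) {f : Sph n → ℂ}
    (hf : ∀ (z₀ : ℂ) (y : Sph n), homCoord z₀ y i * u y = z₀ * f y) :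
    gjms n (m + 1) w w' f z = (1 / 2) ^ (m + 1) *
      (homCoord 1 z i * ((smoothLaplacian n ^ (m + 1)) G : Amb n → ℂ) (homCoord 1 z) +
        (m + 1) * (-2 * lorentzSign n i) *
          dζbar i ((smoothLaplacian n ^ m) G : smoothFunctions (Amb n)) (homCoord 1 z)) := by
  have hweight : ((m + 1 : ℕ) : ℂ) = w + w' + n + 1 := by
    push_cast
    linear_combination hm
  rw [gjms_eq hweight (hG.coordFn_mul i hf)]
  congr 1
  have hpow := (ambCalculus n).laplacian_pow_succ_z_mul (fun i => -2 * lorentzSign n i) i m G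
  refine (congr_fun (congrArg Subtype.val hpow) (homCoord 1 z)).trans ?_
  change _ + (m + 1) • ((-2 * lorentzSign n i) * _) = _
  rw [nsmul_eq_mul, Nat.cast_succ, ← mul_assoc]
  rfl

theorem commMul_gjms_coord {m : ℕ} (hm : (m : ℂ) = w - 1 + w' + n + 1)
    (hG : IsAmbientExtension (w - 1) w' u z G) (j : Fin (n + 1)) :
    commMul (gjms n (m + 1) w w') (coord j) u z = -(m + 1) * (1 / 2) ^ m *
      (dζbar j.succ ((smoothLaplacian n ^ m) G : smoothFunctions (Amb n)) (homCoord 1 z) +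
        coord j z *
          dζbar 0 ((smoothLaplacian n ^ m) G : smoothFunctions (Amb n)) (homCoord 1 z)) := by
  have hu := gjms_succ_eq_of_coordFn_mul (f := u) hm hG 0 fun _ _ => rfl
  have hcoord_u := gjms_succ_eq_of_coordFn_mul (f := fun y => coord j y * u y) hm hG j.succ
    fun _ _ => mul_assoc _ _ _
  rw [commMul, hu, hcoord_u, homCoord_one_zero, homCoord_one_succ, lorentzSign, Fin.cons_zero,
    Fin.cons_succ]
  ring

theorem eulerZbar_smoothLaplacian_pow {ζ : Amb n} (hG : IsHomogeneousNear w w' G ζ) (m : ℕ) :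
    eulerZbar ((smoothLaplacian n ^ m) G : smoothFunctions (Amb n)) ζ =
      (w' - m) * ((smoothLaplacian n ^ m) G : Amb n → ℂ) ζ := by
  have hZbar := (isHomogeneousNear_coe_iff.1 hG).2
  have hlocal := (eventuallyEq_ambLaplacian_iterate hZbar m).self_of_nhds
  rw [← coe_smoothLaplacian_pow, ← coe_smoothLaplacian_pow, map_smul] at hlocal
  rw [← coe_eulerBar, (ambCalculus n).eulerBar_laplacian_pow]
  change _ - m • (_ : ℂ) = _
  rw [hlocal, nsmul_eq_mul, sub_mul]
  rfl

theorem sum_conj_coord_mul_commMul_gjms_coord {m : ℕ} (hm : (m : ℂ) = w - 1 + w' + n + 1)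
    (hG : IsAmbientExtension (w - 1) w' u z G) :
    ∑ j, conj (coord j z) * commMul (gjms n (m + 1) w w') (coord j) u z =
      -(m + 1) * (1 / 2) ^ m *
        eulerZbar ((smoothLaplacian n ^ m) G : smoothFunctions (Amb n)) (homCoord 1 z) := by
  set M := (smoothLaplacian n ^ m) G
  set p := homCoord 1 z
  have hEuler : eulerZbar M p =
      dζbar 0 M p + ∑ j : Fin (n + 1), conj (coord j z) * dζbar j.succ M p := by
    simp only [eulerZbar, Fin.sum_univ_succ, p, homCoord_one_zero, homCoord_one_succ, map_one,
      one_mul]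
  calc ∑ j, conj (coord j z) * commMul (gjms n (m + 1) w w') (coord j) u z
      = -(m + 1) * (1 / 2) ^ m * ((∑ j, conj (coord j z) * coord j z) * dζbar 0 M p +
          ∑ j : Fin (n + 1), conj (coord j z) * dζbar j.succ M p) := by
        rw [Finset.sum_mul, ← Finset.sum_add_distrib, Finset.mul_sum]
        refine Finset.sum_congr rfl fun j _ => ?_
        rw [commMul_gjms_coord hm hG]
        ring
    _ = -(m + 1) * (1 / 2) ^ m * eulerZbar M p := by
        rw [sum_conj_coord_mul_coord, one_mul, hEuler]

end Commutator

end CRSphere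

end

theorem theorem4p2 (n k : ℕ) (hk : 1 ≤ k) (w w' : ℂ) (hw : (k : ℂ) = w + w' + n + 1)
    (u : CRSphere.Sph n → ℂ) (hu : CRSphere.SmoothOnSphere n u) (z : CRSphere.Sph n) :
    ∑ j : Fin (n + 1), conj (CRSphere.coord j z) *
        CRSphere.commMul (CRSphere.gjms n k w w') (CRSphere.coord j) u z =
      -(k : ℂ) * (w' - k + 1) * CRSphere.gjms n (k - 1) (w - 1) w' u z := by
  open CRSphere in
  obtain ⟨m, rfl⟩ := Nat.exists_eq_add_of_le' hk
  have hm : (m : ℂ) = w - 1 + w' + n + 1 := by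
    push_cast at hw
    linear_combination hw
  obtain ⟨G, hG⟩ := exists_smoothFunctions_isAmbientExtension (w - 1) w' hu z
  rw [Nat.add_sub_cancel, gjms_eq hm hG, sum_conj_coord_mul_commMul_gjms_coord hm hG,
    eulerZbar_smoothLaplacian_pow hG.1]
  push_cast
  ring
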